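/- Let $n\ge 0$ and let $f\colon\mathbb{R}^n\to\mathbb{R}$ be a polynomial function. Call a point critical for a differentiable map if the rank of its differential there is smaller than the dimension of the target. Let $\mathrm{Sing} f$ be the set of critical points of $f$, i.e. the zero set of its gradient. For $a\in\mathbb{R}^n$ put $\rho_a(x)=(x_1-a_1)^2+\dots+(x_n-a_n)^2$, and let the Milnor set $M_a(f)$ be the set of critical points of the map $(f,\rho_a)\colon\mathbb{R}^n\to\mathbb{R}^2$. Then there is an open dense set $\Omega_f\subset\mathbb{R}^n$ such that, for every $a\in\Omega_f$, the set $M_a(f)\setminus\mathrm{Sing} f$ is either empty or a nonsingular curve. Here a nonsingular curve is a nonempty set $C\subset\mathbb{R}^n$ (not necessarily closed or connected), $n\ge 1$, with both of the following properties. First, $C$ is an embedded $C^\infty$ submanifold of $\mathbb{R}^n$ of dimension $1$. Second, $C$ is nonsingular of dimension $1$ as a real algebraic set: for every $x\in C$ there are real polynomials $h,P_1,\dots,P_{n-1}$ on $\mathbb{R}^n$ such that $h(x)\ne 0$, such that $C\cap\{h\ne 0\}=\{P_1=\dots=P_{n-1}=0\}\cap\{h\neq 0\}$, and such that the differentials of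 $P_1,\dots,P_{n-1}$ at $x$ are linearly independent. -/

import Mathlib

open scoped ContDiff

noncomputable section

namespace MilnorCurve

/-- The polynomial function `ℝⁿ → ℝ` defined by a polynomial with real coefficients. -/
def polyFun {n : ℕ} (p : MvPolynomial (Fin n) ℝ) (x : EuclideanSpace ℝ (Fin n)) : ℝ :=
  MvPolynomial.eval (fun i => x i) p

/-- The critical set of a (differentiable) map: the points at which the rank of the differential is
smaller than the dimension of the target. -/
def criticalSet {E F : Type*} [NormedAddCommGroup E] [NormedSpace ℝ E]
    [NormedAddCommGroup F] [NormedSpace ℝ F] (g : E → F) : Set E :=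
  {x | ¬ Function.Surjective (fderiv ℝ g x)}

/-- `ρ_a(x) = (x₁ - a₁)² + ⋯ + (xₙ - aₙ)²`. -/
def rho {n : ℕ} (a x : EuclideanSpace ℝ (Fin n)) : ℝ :=
  ∑ i, (x i - a i) ^ 2

/-- The Milnor set `M_a(f)`: the critical set of the mapping `(f, ρ_a)`. -/
def milnorSet {n : ℕ} {F : Type*} [NormedAddCommGroup F] [NormedSpace ℝ F]
    (f : EuclideanSpace ℝ (Fin n) → F) (a : EuclideanSpace ℝ (Fin n)) :
    Set (EuclideanSpace ℝ (Fin n)) :=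
  criticalSet (fun x => (f x, rho a x))

/-- `S` is an embedded `C^∞` submanifold of `ℝⁿ` of dimension `d`: around each of its points there
is a `C^∞` diffeomorphism between open subsets of `ℝⁿ` which takes `S` to the coordinate
`d`-plane on which all but the first `d` coordinates vanish. -/
def IsSmoothSubmanifold {n : ℕ} (d : ℕ) (S : Set (EuclideanSpace ℝ (Fin n))) : Prop :=
  d ≤ n ∧ ∀ x ∈ S,
    ∃ φ : OpenPartialHomeomorph (EuclideanSpace ℝ (Fin n)) (EuclideanSpace ℝ (Fin n)),
      x ∈ φ.source ∧ ContDiffOn ℝ ∞ φ φ.source ∧ ContDiffOn ℝ ∞ φ.symm φ.target ∧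
      ∀ y ∈ φ.source, (y ∈ S ↔ ∀ i : Fin n, d ≤ (i : ℕ) → φ y i = 0)

/-- `S` is, as a real algebraic subset of `ℝⁿ`, nonsingular of dimension `d`: around each of its
points, in the Zariski topology, it is the zero set of `n - d` polynomials whose differentials at
that point are linearly independent. -/
def IsAlgebraicallyNonsingular {n : ℕ} (d : ℕ) (S : Set (EuclideanSpace ℝ (Fin n))) : Prop :=
  d ≤ n ∧ ∀ x ∈ S, ∃ (h : MvPolynomial (Fin n) ℝ) (P : Fin (n - d) → MvPolynomial (Fin n) ℝ),
    polyFun h x ≠ 0 ∧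
    (∀ y, polyFun h y ≠ 0 → (y ∈ S ↔ ∀ j, polyFun (P j) y = 0)) ∧
    LinearIndependent ℝ (fun j => fderiv ℝ (polyFun (P j)) x)

/-- A nonsingular curve in `ℝⁿ` (not necessarily closed or connected): a nonempty set that is an
embedded `C^∞` submanifold of dimension one, cut out near each of its points by `n - 1` polynomial
equations with independent differentials. -/
structure IsNonsingularCurve {n : ℕ} (C : Set (EuclideanSpace ℝ (Fin n))) : Prop where
  nonempty : C.Nonempty
  smooth : IsSmoothSubmanifold 1 C
  algebraic : IsAlgebraicallyNonsingular 1 C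

end MilnorCurve

end

/-! Where `∇f(x) ≠ 0`, the point `x` lies in the Milnor set of `a` exactly when `a = x - t ∇f(x)`
for some `t`, that is, when `a` is the value at `(x, t)` of a polynomial map `N : ℝⁿ⁺¹ → ℝⁿ`
(`normalMap`). An algebraic Sard theorem puts the critical values of `N` in the zeros of a nonzero
polynomial `Q`, and `Ω = {Q ≠ 0}` is open and dense. For a regular value `a`, surjectivity of `dN`
makes the `n - 1` minors that involve a fixed `i` with `∂ᵢf(x) ≠ 0` have independent differentials;
the inverse function theorem then gives smoothness.

Sard is proved prime by prime: modulo a minimal prime of the ideal of maximal minors, the components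
of the map are algebraically dependent, since otherwise derivations dual to them would produce a
nonzero minor. The product of these relations is `Q`. -/

/-! ### Derivations and the algebraic Sard theorem -/

/-- A derivation to a field extends along a formally smooth extension. -/
theorem Derivation.exists_extension_of_formallySmooth {K A L : Type*} [CommRing K] [CommRing A]
    [Field L] [Algebra K A] [Algebra A L] [Algebra K L] [IsScalarTower K A L]
    [Algebra.FormallySmooth A L] (d : Derivation K A L) :
    ∃ D : Derivation K L L, ∀ a, D (algebraMap A L a) = d a := by
  -- Formal smoothness kills `H1Cotangent`, so `L ⊗ Ω[A/K]` embeds in `Ω[L/K]`; over the field `L`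
  -- it is a direct summand, and `d` extends along a retraction.
  have hinj : Function.Injective (KaehlerDifferential.mapBaseChange K A L) := by
    rw [injective_iff_map_eq_zero]
    intro x hx
    obtain ⟨y, rfl⟩ := (Algebra.H1Cotangent.exact_δ_mapBaseChange K A L x).mp hx
    rw [Subsingleton.elim y 0, map_zero]
  obtain ⟨r, hr⟩ := LinearMap.exists_leftInverse_of_injective _ (LinearMap.ker_eq_bot.mpr hinj)
  refine ⟨((d.liftKaehlerDifferential.liftBaseChange L).comp r).compDer
    (KaehlerDifferential.D K L), fun a => ?_⟩
  have h1 : r (KaehlerDifferential.D K L (algebraMap A L a)) = 1 ⊗ₜ KaehlerDifferential.D K A a := by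
    have := LinearMap.congr_fun hr (1 ⊗ₜ KaehlerDifferential.D K A a)
    simpa using this
  simp [h1]

theorem Algebra.FormallySmooth.of_charZero (K L : Type*) [Field K] [Field L] [CharZero K]
    [Algebra K L] : Algebra.FormallySmooth K L := by
  obtain ⟨s, hs⟩ := exists_isTranscendenceBasis K L
  have : Algebra.IsAlgebraic (IntermediateField.adjoin K (Set.range ((↑) : s → L))) L :=
    hs.isAlgebraic_field
  exact .of_algebraicIndependent_of_isSeparable hs.1

/-- The values may be prescribed freely on the polynomial ring in the `y i`, and `L` is formally
smooth over it: localize, then use characteristic zero. -/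
theorem AlgebraicIndependent.exists_derivation {K L ι : Type*} [Field K] [Field L] [CharZero K]
    [Algebra K L] {y : ι → L} (hy : AlgebraicIndependent K y) (v : ι → L) :
    ∃ D : Derivation K L L, ∀ i, D (y i) = v i := by
  let _ : Algebra (MvPolynomial ι K) L := (MvPolynomial.aeval y).toAlgebra
  have : IsScalarTower K (MvPolynomial ι K) L := .of_algebraMap_eq' (MvPolynomial.aeval y).comp_algebraMap.symm
  have : FaithfulSMul (MvPolynomial ι K) L := (faithfulSMul_iff_algebraMap_injective _ _).mpr hy
  let _ : Algebra (FractionRing (MvPolynomial ι K)) L := FractionRing.liftAlgebra _ L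
  have : IsScalarTower (MvPolynomial ι K) (FractionRing (MvPolynomial ι K)) L := inferInstance
  have : CharZero (FractionRing (MvPolynomial ι K)) := inferInstance
  have : Algebra.FormallySmooth (MvPolynomial ι K) (FractionRing (MvPolynomial ι K)) :=
    .of_isLocalization (nonZeroDivisors _)
  have : Algebra.FormallySmooth (FractionRing (MvPolynomial ι K)) L := .of_charZero _ _
  have : Algebra.FormallySmooth (MvPolynomial ι K) L := .comp _ (FractionRing (MvPolynomial ι K)) _
  obtain ⟨D, hD⟩ := Derivation.exists_extension_of_formallySmooth
    (MvPolynomial.mkDerivation K v : Derivation K (MvPolynomial ι K) L)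
  refine ⟨D, fun i => ?_⟩
  have := hD (MvPolynomial.X i)
  rw [MvPolynomial.mkDerivation_X] at this
  rw [← this, RingHom.algebraMap_toAlgebra]
  simp

theorem Derivation.apply_mvPolynomial_aeval {K L σ : Type*} [CommRing K] [CommRing L] [Algebra K L]
    [Fintype σ] (D : Derivation K L L) (z : σ → L) (p : MvPolynomial σ K) :
    D (MvPolynomial.aeval z p) =
      ∑ k, D (z k) * MvPolynomial.aeval z (MvPolynomial.pderiv k p) := by
  classical
  induction p using MvPolynomial.induction_on with
  | C a => simp
  | add p q hp hq => simp [hp, hq, mul_add, Finset.sum_add_distrib]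
  | mul_X p i hp =>
    simp [hp, mul_add, Finset.sum_add_distrib, MvPolynomial.pderiv_X, Pi.single_apply,
      Finset.mul_sum, apply_ite, mul_comm, mul_left_comm, add_comm]

open Matrix in
/-- If a matrix has a right inverse, then one of its maximal minors does not vanish. -/
theorem Matrix.exists_det_submatrix_ne_zero {R ι σ : Type*} [CommRing R] [Nontrivial R] [Fintype ι]
    [DecidableEq ι] [Fintype σ] {J : Matrix ι σ R} {X : Matrix σ ι R} (h : J * X = 1) :
    ∃ s : ι → σ, (J.submatrix id s).det ≠ 0 := by
  classical
  by_contra! hs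
  have hrow : (J * X)ᵀ = fun j => ∑ k, X k j • (fun i => J i k) := by
    ext j i
    simp [Matrix.mul_apply, mul_comm]
  have : (J * X)ᵀ.det = 0 := by
    -- Multilinear expansion, as in Cauchy–Binet: every term is a multiple of a maximal minor of
    -- `J`.
    rw [hrow]
    change Matrix.detRowAlternating (fun j => ∑ k, X k j • (fun i => J i k)) = 0
    rw [← AlternatingMap.coe_multilinearMap, MultilinearMap.map_sum]
    refine Finset.sum_eq_zero fun s _ => ?_
    rw [MultilinearMap.map_smul_univ]
    have h2 : Matrix.det (J.submatrix id s)ᵀ = 0 := by rw [Matrix.det_transpose, hs]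
    have h3 : Matrix.detRowAlternating.toMultilinearMap (fun j i => J i (s j)) = 0 := h2
    simp [h3]
  simp [h] at this

/-- The Jacobian criterion for algebraic independence in characteristic zero. -/
theorem AlgebraicIndependent.exists_jacobian_minor_ne_zero {K L ι σ : Type*} [Field K] [CharZero K]
    [Field L] [Algebra K L] [Fintype ι] [DecidableEq ι] [Fintype σ] {z : σ → L}
    {G : ι → MvPolynomial σ K} (h : AlgebraicIndependent K fun i => MvPolynomial.aeval z (G i)) :
    ∃ s : ι → σ, (Matrix.of fun i j =>
      MvPolynomial.aeval z (MvPolynomial.pderiv (s j) (G i))).det ≠ 0 := by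
  -- By the chain rule, the matrix `D j (z k)` of these dual derivations is a right inverse of the
  -- Jacobian.
  choose D hD using fun j : ι => h.exists_derivation (Pi.single j 1)
  refine Matrix.exists_det_submatrix_ne_zero (X := Matrix.of fun k j => D j (z k))
    (J := Matrix.of fun i k => MvPolynomial.aeval z (MvPolynomial.pderiv k (G i))) ?_
  ext i j
  have := hD j i
  rw [Derivation.apply_mvPolynomial_aeval] at this
  simp only [Matrix.mul_apply, Matrix.of_apply, mul_comm (MvPolynomial.aeval z _), this,
    Matrix.one_apply, Pi.single_apply]

/-- **Algebraic Sard theorem**: the critical values of a polynomial map in characteristic zero lie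
in the zero set of a nonzero polynomial. -/
theorem MvPolynomial.exists_ne_zero_forall_jacobian_surjective {K ι σ : Type*} [Field K]
    [CharZero K] [Fintype ι] [Fintype σ] (G : ι → MvPolynomial σ K) :
    ∃ Q : MvPolynomial ι K, Q ≠ 0 ∧ ∀ x : σ → K, eval (fun i => eval x (G i)) Q ≠ 0 →
      ∀ w : ι → K, ∃ u : σ → K, ∀ i, ∑ k, u k * eval x (pderiv k (G i)) = w i := by
  classical
  let minor (s : ι → σ) : MvPolynomial σ K := (Matrix.of fun i j => pderiv (s j) (G i)).det
  let I : Ideal (MvPolynomial σ K) := Ideal.span (Set.range minor)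
  have key : ∀ P ∈ I.minimalPrimes, ∃ Q : MvPolynomial ι K, Q ≠ 0 ∧ aeval G Q ∈ P := by
    intro P hP
    have hPp : P.IsPrime := hP.1.1
    by_contra! hQ
    let L := FractionRing (MvPolynomial σ K ⧸ P)
    let ψ : MvPolynomial σ K →ₐ[K] L :=
      (IsScalarTower.toAlgHom K (MvPolynomial σ K ⧸ P) L).comp (Ideal.Quotient.mkₐ K P)
    have hψ : ∀ p, ψ p = 0 ↔ p ∈ P := fun p => by
      simp only [ψ, AlgHom.comp_apply, IsScalarTower.coe_toAlgHom', Ideal.Quotient.mkₐ_eq_mk,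
        FaithfulSMul.algebraMap_eq_zero_iff, Ideal.Quotient.eq_zero_iff_mem]
    have hψa : aeval (fun k => ψ (X k)) = ψ := by ext; simp
    have hind : AlgebraicIndependent K fun i => aeval (fun k => ψ (X k)) (G i) := by
      rw [algebraicIndependent_iff]
      intro Q hQ0
      by_contra hne
      refine hQ Q hne ((hψ _).mp ?_)
      rw [hψa] at hQ0
      rw [← hQ0, comp_aeval_apply]
    obtain ⟨s, hs⟩ := hind.exists_jacobian_minor_ne_zero
    apply hs
    have hm : minor s ∈ P := hP.1.2 (Ideal.subset_span ⟨s, rfl⟩)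
    rw [← hψ, AlgHom.map_det] at hm
    rw [hψa]
    exact hm
  choose! Q hQ0 hQ using key
  have hfin : I.minimalPrimes.Finite := Ideal.finite_minimalPrimes_of_isNoetherianRing _ I
  refine ⟨∏ P ∈ hfin.toFinset, Q P, Finset.prod_ne_zero_iff.mpr fun P hP =>
    hQ0 P (hfin.mem_toFinset.mp hP), fun x hx => ?_⟩
  have hrad : aeval G (∏ P ∈ hfin.toFinset, Q P) ∈ I.radical := by
    rw [← Ideal.sInf_minimalPrimes, Ideal.mem_sInf]
    intro P hP
    rw [map_prod]
    exact Ideal.mem_of_dvd _ (Finset.dvd_prod_of_mem _ (hfin.mem_toFinset.mpr hP)) (hQ P hP)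
  have hex : ∃ s, eval x (minor s) ≠ 0 := by
    by_contra! hs
    obtain ⟨k, hk⟩ := hrad
    have hle : I ≤ RingHom.ker (eval x) := Ideal.span_le.mpr (by rintro _ ⟨s, rfl⟩; exact hs s)
    have h0 := hle hk
    rw [RingHom.mem_ker, map_pow] at h0
    apply hx
    rw [← eq_zero_of_pow_eq_zero h0, ← coe_aeval_eq_eval, RingHom.coe_coe, ← coe_aeval_eq_eval, RingHom.coe_coe,
      comp_aeval_apply]
  obtain ⟨s, hs⟩ := hex
  intro w
  rw [RingHom.map_det] at hs
  set M := (eval x).mapMatrix (Matrix.of fun i j => pderiv (s j) (G i)) with hM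
  -- Summing over the fibres of `s` avoids having to show that `s` is injective.
  refine ⟨fun k => ∑ j with s j = k, M⁻¹.mulVec w j, fun i => ?_⟩
  have h1 : M.mulVec (M⁻¹.mulVec w) = w := by
    rw [Matrix.mulVec_mulVec, Matrix.mul_nonsing_inv _ (isUnit_iff_ne_zero.mpr hs),
      Matrix.one_mulVec]
  rw [← congrFun h1 i]
  simp only [Finset.sum_mul, Matrix.mulVec, dotProduct]
  rw [← Finset.sum_fiberwise Finset.univ s]
  refine Finset.sum_congr rfl fun k _ => Finset.sum_congr rfl fun j hj => ?_
  rw [(Finset.mem_filter.mp hj).2.symm, mul_comm]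
  simp [hM, Finset.sum_mul]

/-! ### Polynomial functions and equations of the Milnor set -/

namespace MilnorCurve

variable {n : ℕ}

theorem analyticOnNhd_polyFun (p : MvPolynomial (Fin n) ℝ) :
    AnalyticOnNhd ℝ (polyFun p) Set.univ :=
  AnalyticOnNhd.eval_linearMap'
    (fun i => (EuclideanSpace.proj i : EuclideanSpace ℝ (Fin n) →L[ℝ] ℝ).toLinearMap) p

theorem contDiff_polyFun (p : MvPolynomial (Fin n) ℝ) {k : WithTop ℕ∞} : ContDiff ℝ k (polyFun p) :=
  contDiff_iff_contDiffAt.mpr fun x => (analyticOnNhd_polyFun p x trivial).contDiffAt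

theorem hasFDerivAt_polyFun (p : MvPolynomial (Fin n) ℝ) (x : EuclideanSpace ℝ (Fin n)) :
    HasFDerivAt (polyFun p) (∑ k, polyFun (MvPolynomial.pderiv k p) x •
      (EuclideanSpace.proj k : EuclideanSpace ℝ (Fin n) →L[ℝ] ℝ)) x := by
  classical
  induction p using MvPolynomial.induction_on with
  | C a =>
    convert! hasFDerivAt_const (𝕜 := ℝ) a x using 1
    · ext y; simp [polyFun]
    · simp [polyFun]
  | add p q hp hq =>
    convert! hp.add hq using 1
    · ext y; simp [polyFun]
    · simp [polyFun, add_smul, Finset.sum_add_distrib]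
  | mul_X p i hp =>
    convert! hp.mul (EuclideanSpace.proj i : EuclideanSpace ℝ (Fin n) →L[ℝ] ℝ).hasFDerivAt using 1
    · ext y; simp [polyFun]
    · ext v
      simp [polyFun, MvPolynomial.pderiv_X, Pi.single_apply, add_mul, Finset.sum_add_distrib,
        Finset.mul_sum, apply_ite, mul_assoc]

theorem fderiv_polyFun_apply (p : MvPolynomial (Fin n) ℝ) (x v : EuclideanSpace ℝ (Fin n)) :
    fderiv ℝ (polyFun p) x v = ∑ k, polyFun (MvPolynomial.pderiv k p) x * v k := by
  simp [(hasFDerivAt_polyFun p x).fderiv]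

theorem isOpen_polyFun_ne_zero (p : MvPolynomial (Fin n) ℝ) : IsOpen {x | polyFun p x ≠ 0} :=
  isOpen_ne_fun (contDiff_polyFun p (k := 0)).continuous continuous_const

theorem dense_polyFun_ne_zero {p : MvPolynomial (Fin n) ℝ} (hp : p ≠ 0) :
    Dense {x | polyFun p x ≠ 0} := by
  rw [← Set.compl_ofPred, ← interior_eq_empty_iff_dense_compl, Set.eq_empty_iff_forall_notMem]
  intro x hx
  refine hp (MvPolynomial.funext fun y => ?_)
  have := (analyticOnNhd_polyFun p).eqOn_zero_of_preconnected_of_eventuallyEq_zero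
    isPreconnected_univ (Set.mem_univ x) (mem_interior_iff_mem_nhds.mp hx)
    (Set.mem_univ (WithLp.toLp 2 y))
  simpa [polyFun] using this

theorem mem_criticalSet_polyFun_iff (p : MvPolynomial (Fin n) ℝ) (x : EuclideanSpace ℝ (Fin n)) :
    x ∈ criticalSet (polyFun p) ↔ ∀ i, polyFun (MvPolynomial.pderiv i p) x = 0 := by
  constructor
  · intro h i
    by_contra hi
    refine h fun c => ⟨(c / polyFun (MvPolynomial.pderiv i p) x) • EuclideanSpace.single i 1, ?_⟩
    rw [fderiv_polyFun_apply]
    simp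
    field_simp
  · intro h hs
    obtain ⟨v, hv⟩ := hs 1
    simp [fderiv_polyFun_apply, h] at hv

theorem hasFDerivAt_rho (a x : EuclideanSpace ℝ (Fin n)) :
    HasFDerivAt (rho a) (∑ k, (2 * (x k - a k)) •
      (EuclideanSpace.proj k : EuclideanSpace ℝ (Fin n) →L[ℝ] ℝ)) x := by
  unfold rho
  refine HasFDerivAt.fun_sum fun k _ => ?_
  convert! (((EuclideanSpace.proj k : EuclideanSpace ℝ (Fin n) →L[ℝ] ℝ).hasFDerivAt
    (x := x)).sub_const (a k)).pow 2 using 1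
  ext v
  simp
  

/-- Where `∂ᵢ f` does not vanish, the Milnor set is the vanishing locus of the minors
`(xⱼ - aⱼ) ∂ᵢ f - (xᵢ - aᵢ) ∂ⱼ f`. -/
theorem mem_milnorSet_polyFun_iff (f : MvPolynomial (Fin n) ℝ) (a x : EuclideanSpace ℝ (Fin n))
    {i : Fin n} (hi : polyFun (MvPolynomial.pderiv i f) x ≠ 0) :
    x ∈ milnorSet (polyFun f) a ↔ ∀ j, (x j - a j) * polyFun (MvPolynomial.pderiv i f) x =
      (x i - a i) * polyFun (MvPolynomial.pderiv j f) x := by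
  have hd : ∀ v, fderiv ℝ (fun y => (polyFun f y, rho a y)) x v =
      (∑ k, polyFun (MvPolynomial.pderiv k f) x * v k, ∑ k, 2 * (x k - a k) * v k) := fun v => by
    rw [((hasFDerivAt_polyFun f x).prodMk (hasFDerivAt_rho a x)).fderiv]
    simp
  constructor
  · intro h j
    by_contra hj
    set fi := polyFun (MvPolynomial.pderiv i f) x
    set fj := polyFun (MvPolynomial.pderiv j f) x
    have hne : fi * (x j - a j) - fj * (x i - a i) ≠ 0 := by
      rwa [mul_comm fi, mul_comm fj, sub_ne_zero]
    -- Cramer's rule in the coordinates `i` and `j`.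
    refine h fun c => ⟨((c.1 * (2 * (x j - a j)) - c.2 * fj) /
      (2 * (fi * (x j - a j) - fj * (x i - a i)))) • EuclideanSpace.single i 1 +
      ((c.2 * fi - c.1 * (2 * (x i - a i))) /
      (2 * (fi * (x j - a j) - fj * (x i - a i)))) • EuclideanSpace.single j 1, ?_⟩
    rw [hd]
    ext
    · simp [mul_add, Finset.sum_add_distrib]
      change fi * _ + fj * _ = _
      field
    · simp [mul_add, Finset.sum_add_distrib]
      field
  · intro h hs
    obtain ⟨v, hv⟩ := hs (0, 1)
    rw [hd, Prod.mk.injEq] at hv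
    have : ∑ k, 2 * (x k - a k) * v k = 2 * ((x i - a i) / polyFun (MvPolynomial.pderiv i f) x) *
        ∑ k, polyFun (MvPolynomial.pderiv k f) x * v k := by
      rw [Finset.mul_sum]
      refine Finset.sum_congr rfl fun k _ => ?_
      field_simp
      linear_combination v k * h k
    rw [hv.1, hv.2] at this
    simp at this

/-! ### From algebraic to smooth nonsingularity -/

/-- A nonsingular real algebraic curve is a smooth submanifold. -/
theorem IsAlgebraicallyNonsingular.isSmoothSubmanifold_one {S : Set (EuclideanSpace ℝ (Fin n))}
    (hS : IsAlgebraicallyNonsingular 1 S) : IsSmoothSubmanifold 1 S := by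
  refine ⟨hS.1, fun x hx => ?_⟩
  obtain ⟨m, rfl⟩ : ∃ m, n = m + 1 := ⟨n - 1, by have := hS.1; omega⟩
  obtain ⟨h, P, hhx, hP, hlin⟩ := hS.2 x hx
  let E := EuclideanSpace ℝ (Fin (m + 1))
  let P' : Fin m → MvPolynomial (Fin (m + 1)) ℝ := P
  have hdim : Module.finrank ℝ (E →L[ℝ] ℝ) = m + 1 := by
    rw [← (LinearMap.toContinuousLinearMap (𝕜 := ℝ) (E := E) (F' := ℝ)).finrank_eq]
    exact (Subspace.dual_finrank_eq (K := ℝ) (V := E)).trans finrank_euclideanSpace_fin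
  -- `l` completes the differentials to a basis of the dual space and serves as the coordinate along
  -- the curve.
  obtain ⟨l, hl⟩ : ∃ l : E →L[ℝ] ℝ,
      l ∉ Submodule.span ℝ (Set.range fun j => fderiv ℝ (polyFun (P' j)) x) := by
    by_contra! hl
    have h1 := finrank_range_le_card (R := ℝ) (fun j => fderiv ℝ (polyFun (P' j)) x)
    rw [Set.finrank, Submodule.eq_top_iff'.mpr hl, finrank_top, hdim, Fintype.card_fin] at h1
    omega
  have hli : LinearIndependent ℝ
      (Fin.cons l (fun j => fderiv ℝ (polyFun (P' j)) x) : Fin (m + 1) → E →L[ℝ] ℝ) :=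
    linearIndependent_finCons.mpr ⟨hlin, hl⟩
  let Φ : E → E := fun y => WithLp.toLp 2 (Fin.cons (l y) (fun j => polyFun (P' j) y))
  have hΦ : ContDiff ℝ ∞ Φ := by
    rw [contDiff_euclidean]
    intro i
    refine Fin.cases ?_ (fun j => ?_) i
    · exact l.contDiff
    · exact contDiff_polyFun (P' j)
  have hΦd : ∀ v i, fderiv ℝ Φ x v i =
      (Fin.cons l (fun j => fderiv ℝ (polyFun (P' j)) x) : Fin (m + 1) → E →L[ℝ] ℝ) i v := by
    intro v i
    have h1 : HasFDerivAt (fun y => Φ y i)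
        ((EuclideanSpace.proj i : E →L[ℝ] ℝ).comp (fderiv ℝ Φ x)) x :=
      (EuclideanSpace.proj i : E →L[ℝ] ℝ).hasFDerivAt.comp x
        (hΦ.differentiable (by simp) x).hasFDerivAt
    have h2 : HasFDerivAt (fun y => Φ y i)
        ((Fin.cons l (fun j => fderiv ℝ (polyFun (P' j)) x) : Fin (m + 1) → E →L[ℝ] ℝ) i) x := by
      refine Fin.cases ?_ (fun j => ?_) i
      · exact l.hasFDerivAt
      · exact ((contDiff_polyFun (P' j) (k := 1)).differentiable (by simp) x).hasFDerivAt
    rw [← h1.unique h2]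
    rfl
  have hinj : Function.Injective (fderiv ℝ Φ x) := by
    rw [injective_iff_map_eq_zero]
    intro v hv
    have hspan := hli.span_eq_top_of_card_eq_finrank' (by rw [hdim, Fintype.card_fin])
    have hker : Submodule.span ℝ (Set.range (Fin.cons l fun j => fderiv ℝ (polyFun (P' j)) x :
        Fin (m + 1) → E →L[ℝ] ℝ)) ≤ LinearMap.ker (ContinuousLinearMap.apply ℝ ℝ v).toLinearMap := by
      rw [Submodule.span_le]
      rintro _ ⟨i, rfl⟩
      change _ = (0 : ℝ)
      simp [← hΦd, hv]
    rw [hspan] at hker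
    have : inner ℝ v v = 0 := hker (Submodule.mem_top (x := innerSL ℝ v))
    exact inner_self_eq_zero.mp this
  let e : E ≃L[ℝ] E := (LinearEquiv.ofInjectiveEndo (fderiv ℝ Φ x : E →ₗ[ℝ] E) hinj).toContinuousLinearEquiv
  have he : HasFDerivAt Φ (e : E →L[ℝ] E) x :=
    (hΦ.differentiable (by simp) x).hasFDerivAt
  let φ₀ := hΦ.contDiffAt.toOpenPartialHomeomorph Φ he (by simp)
  -- On `U` the equations `P` describe `S`, and `dΦ` is invertible, so the local inverse is smooth
  -- at every point of the target.
  let U : Set E := {y | polyFun h y ≠ 0} ∩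
    fderiv ℝ Φ ⁻¹' Set.range ((↑) : (E ≃L[ℝ] E) → E →L[ℝ] E)
  have hU : IsOpen U := (isOpen_polyFun_ne_zero h).inter
    (ContinuousLinearEquiv.isOpen.preimage (hΦ.continuous_fderiv (by simp)))
  have hxU : x ∈ U := ⟨hhx, e, he.fderiv.symm⟩
  have hφ₀ : ∀ y, φ₀ y = Φ y := fun y => rfl
  refine ⟨φ₀.restrOpen U hU, ⟨hΦ.contDiffAt.mem_toOpenPartialHomeomorph_source he (by simp), hxU⟩,
    hΦ.contDiffOn, ?_, ?_⟩
  · intro z hz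
    have hz' : z ∈ φ₀.target ∧ φ₀.symm z ∈ φ₀.source ∩ U := by
      have h1 := (φ₀.restrOpen U hU).map_target hz
      have h2 := (φ₀.restrOpen U hU).right_inv hz
      refine ⟨?_, h1⟩
      rw [← h2]
      exact φ₀.map_source h1.1
    obtain ⟨e', he'⟩ := hz'.2.2.2
    have hd : HasFDerivAt φ₀ (e' : E →L[ℝ] E) (φ₀.symm z) := by
      rw [he']
      exact (hΦ.differentiable (by simp) _).hasFDerivAt
    exact (φ₀.contDiffAt_symm hz'.1 hd hΦ.contDiffAt).contDiffWithinAt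
  · intro y hy
    have hy' : y ∈ φ₀.source ∩ U := hy
    rw [hP y hy'.2.1]
    change _ ↔ ∀ i : Fin (m + 1), 1 ≤ (i : ℕ) → Φ y i = 0
    rw [Fin.forall_fin_succ]
    simp [Φ]
    rfl

/-! ### The normal map and its regular values -/

/-- The normal exponential map `(x, t) ↦ x - t ∇f(x)`, whose value at `(x, t)` is `a` precisely when
`x - a = t ∇f(x)`; the coordinate `t` has index `none`. -/
noncomputable def normalMap (f : MvPolynomial (Fin n) ℝ) (i : Fin n) : MvPolynomial (Option (Fin n)) ℝ :=
  MvPolynomial.X (some i) -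
    MvPolynomial.X none * MvPolynomial.rename some (MvPolynomial.pderiv i f)

theorem eval_normalMap (f : MvPolynomial (Fin n) ℝ) (x : EuclideanSpace ℝ (Fin n)) (t : ℝ)
    (i : Fin n) : MvPolynomial.eval (fun o => Option.elim o t x) (normalMap f i) =
      x i - t * polyFun (MvPolynomial.pderiv i f) x := by
  simp [normalMap, MvPolynomial.eval_rename, polyFun, Function.comp_def]

theorem eval_pderiv_none_normalMap (f : MvPolynomial (Fin n) ℝ) (x : EuclideanSpace ℝ (Fin n))
    (t : ℝ) (i : Fin n) :
    MvPolynomial.eval (fun o => Option.elim o t x) (MvPolynomial.pderiv none (normalMap f i)) =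
      -polyFun (MvPolynomial.pderiv i f) x := by
  classical
  have h : MvPolynomial.pderiv none (MvPolynomial.rename some (MvPolynomial.pderiv i f)) = 0 := by
    refine MvPolynomial.pderiv_eq_zero_of_notMem_vars fun hv => ?_
    simpa using MvPolynomial.vars_rename _ _ hv
  simp [normalMap, h, MvPolynomial.pderiv_X, MvPolynomial.eval_rename, polyFun, Function.comp_def]

theorem eval_pderiv_some_normalMap (f : MvPolynomial (Fin n) ℝ) (x : EuclideanSpace ℝ (Fin n))
    (t : ℝ) (i k : Fin n) :
    MvPolynomial.eval (fun o => Option.elim o t x) (MvPolynomial.pderiv (some k) (normalMap f i)) =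
      (if i = k then 1 else 0) -
        t * polyFun (MvPolynomial.pderiv k (MvPolynomial.pderiv i f)) x := by
  classical
  simp [normalMap, MvPolynomial.pderiv_X, MvPolynomial.eval_rename, polyFun, Function.comp_def,
    MvPolynomial.pderiv_rename (Option.some_injective _), Pi.single_apply, apply_ite]

/-- The minor `(xⱼ - aⱼ) ∂ᵢ f - (xᵢ - aᵢ) ∂ⱼ f` of the Jacobian matrix of `(f, ρ_a)`. -/
noncomputable def milnorMinor (f : MvPolynomial (Fin n) ℝ) (a : EuclideanSpace ℝ (Fin n)) (i j : Fin n) :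
    MvPolynomial (Fin n) ℝ :=
  (MvPolynomial.X j - MvPolynomial.C (a j)) * MvPolynomial.pderiv i f -
    (MvPolynomial.X i - MvPolynomial.C (a i)) * MvPolynomial.pderiv j f

theorem polyFun_milnorMinor (f : MvPolynomial (Fin n) ℝ) (a x : EuclideanSpace ℝ (Fin n))
    (i j : Fin n) : polyFun (milnorMinor f a i j) x =
      (x j - a j) * polyFun (MvPolynomial.pderiv i f) x -
        (x i - a i) * polyFun (MvPolynomial.pderiv j f) x := by
  simp [milnorMinor, polyFun]

/-- The derivative of a minor at a point where `x - a = t ∇f(x)`. -/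
theorem fderiv_milnorMinor (f : MvPolynomial (Fin n) ℝ) {a x : EuclideanSpace ℝ (Fin n)} {t : ℝ}
    (hx : ∀ j, x j - a j = t * polyFun (MvPolynomial.pderiv j f) x) (i j : Fin n)
    (v : EuclideanSpace ℝ (Fin n)) :
    fderiv ℝ (polyFun (milnorMinor f a i j)) x v =
      polyFun (MvPolynomial.pderiv i f) x *
        (v j - t * ∑ k, polyFun (MvPolynomial.pderiv k (MvPolynomial.pderiv j f)) x * v k) -
      polyFun (MvPolynomial.pderiv j f) x *
        (v i - t * ∑ k, polyFun (MvPolynomial.pderiv k (MvPolynomial.pderiv i f)) x * v k) := by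
  classical
  rw [fderiv_polyFun_apply]
  have h : ∀ k, polyFun (MvPolynomial.pderiv k (milnorMinor f a i j)) x * v k =
      polyFun (MvPolynomial.pderiv i f) x * ((if j = k then v k else 0) -
        t * (polyFun (MvPolynomial.pderiv k (MvPolynomial.pderiv j f)) x * v k)) -
      polyFun (MvPolynomial.pderiv j f) x * ((if i = k then v k else 0) -
        t * (polyFun (MvPolynomial.pderiv k (MvPolynomial.pderiv i f)) x * v k)) := by
    intro k
    have hj := hx j
    have hi := hx i
    simp only [polyFun] at hi hj ⊢
    simp only [milnorMinor, map_sub, Derivation.leibniz, MvPolynomial.pderiv_X,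
      MvPolynomial.pderiv_C, smul_eq_mul, map_add, map_mul, Pi.single_apply, MvPolynomial.eval_X,
      MvPolynomial.eval_C, sub_zero, hi, hj, apply_ite (MvPolynomial.eval _), map_one, map_zero]
    split_ifs <;> ring
  simp only [h, Finset.sum_sub_distrib, ← Finset.mul_sum, Finset.sum_ite_eq, Finset.mem_univ,
    if_true]

theorem isNonsingularCurve_milnorSet_diff (f : MvPolynomial (Fin n) ℝ)
    {a : EuclideanSpace ℝ (Fin n)}
    (ha : ∀ x : Option (Fin n) → ℝ, (∀ i, MvPolynomial.eval x (normalMap f i) = a i) →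
      ∀ w : Fin n → ℝ, ∃ u : Option (Fin n) → ℝ, ∀ i,
        ∑ k, u k * MvPolynomial.eval x (MvPolynomial.pderiv k (normalMap f i)) = w i)
    (hne : (milnorSet (polyFun f) a \ criticalSet (polyFun f)).Nonempty) :
    IsNonsingularCurve (milnorSet (polyFun f) a \ criticalSet (polyFun f)) := by
  have halg : IsAlgebraicallyNonsingular 1
      (milnorSet (polyFun f) a \ criticalSet (polyFun f)) := by
    obtain ⟨m, rfl⟩ : ∃ m, n = m + 1 := by
      obtain ⟨x, -, hx⟩ := hne
      rw [mem_criticalSet_polyFun_iff] at hx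
      push Not at hx
      obtain ⟨i, -⟩ := hx
      exact ⟨n - 1, by have := i.pos; omega⟩
    refine ⟨by omega, fun x hx => ?_⟩
    obtain ⟨i, hi⟩ : ∃ i, polyFun (MvPolynomial.pderiv i f) x ≠ 0 := by
      have := hx.2
      rw [mem_criticalSet_polyFun_iff] at this
      push Not at this
      exact this
    have hxm := (mem_milnorSet_polyFun_iff f a x hi).mp hx.1
    let P (j : Fin m) := milnorMinor f a i (i.succAbove j)
    refine ⟨MvPolynomial.pderiv i f, P, hi, fun y hy => ?_, ?_⟩
    · have hyc : y ∉ criticalSet (polyFun f) := fun h =>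
        hy ((mem_criticalSet_polyFun_iff f y).mp h i)
      simp only [Set.mem_sdiff, hyc, not_false_eq_true, and_true,
        mem_milnorSet_polyFun_iff f a y hy, Fin.forall_iff_succAbove i, true_and]
      exact forall_congr' fun j => by rw [polyFun_milnorMinor, sub_eq_zero]
    · set t := (x i - a i) / polyFun (MvPolynomial.pderiv i f) x with ht
      have hxt : ∀ j, x j - a j = t * polyFun (MvPolynomial.pderiv j f) x := fun j => by
        rw [ht]
        field_simp
        linear_combination hxm j
      have hsurj := ha (fun o => Option.elim o t x) fun j => by
        rw [eval_normalMap]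
        linear_combination hxt j
      rw [Fintype.linearIndependent_iff]
      intro c hc
      -- Chosen so that the differential of `P j` takes the value `c j` at `v`: the `t`-component of
      -- `u` contributes a multiple of `∇f`, which cancels in the minors. The relation `hc`
      -- evaluated at `v` then reads `∑ c j ^ 2 = 0`.
      obtain ⟨u, hu⟩ := hsurj (i.insertNth 0 fun j => c j / polyFun (MvPolynomial.pderiv i f) x)
      let v : EuclideanSpace ℝ (Fin (m + 1)) := WithLp.toLp 2 fun k => u (some k)
      have huv : ∀ j, v j - t * ∑ k,
          polyFun (MvPolynomial.pderiv k (MvPolynomial.pderiv j f)) x * v k =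
          u none * polyFun (MvPolynomial.pderiv j f) x + (i.insertNth 0 fun j =>
            c j / polyFun (MvPolynomial.pderiv i f) x : Fin (m + 1) → ℝ) j := by
        intro j
        rw [← hu j, Fintype.sum_option, eval_pderiv_none_normalMap]
        simp only [eval_pderiv_some_normalMap, mul_sub, Finset.sum_sub_distrib, mul_ite, mul_one,
          mul_zero, Finset.sum_ite_eq, Finset.mem_univ, if_true, Finset.mul_sum, v]
        simp only [mul_comm, mul_left_comm]
        ring
      have hval : ∀ j, fderiv ℝ (polyFun (P j)) x v = c j := fun j => by
        rw [fderiv_milnorMinor f hxt, huv, huv]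
        simp only [Fin.insertNth_apply_succAbove, Fin.insertNth_apply_same]
        field_simp
        ring
      have hsq : ∑ j, c j * c j = 0 := by
        have := congrArg (fun L : _ →L[ℝ] ℝ => L v) hc
        simpa [hval] using this
      intro j
      exact mul_self_eq_zero.mp
        ((Finset.sum_eq_zero_iff_of_nonneg fun j _ => mul_self_nonneg (c j)).mp hsq j
          (Finset.mem_univ j))
  exact ⟨hne, halg.isSmoothSubmanifold_one, halg⟩

end MilnorCurve

theorem lemma2p3 (n : ℕ) (f : MvPolynomial (Fin n) ℝ) :
    ∃ Ω : Set (EuclideanSpace ℝ (Fin n)), IsOpen Ω ∧ Dense Ω ∧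
      ∀ a ∈ Ω,
        MilnorCurve.IsNonsingularCurve
            (MilnorCurve.milnorSet (MilnorCurve.polyFun f) a \
              MilnorCurve.criticalSet (MilnorCurve.polyFun f)) ∨
          MilnorCurve.milnorSet (MilnorCurve.polyFun f) a \
              MilnorCurve.criticalSet (MilnorCurve.polyFun f) = ∅ := by
  obtain ⟨Q, hQ0, hQ⟩ :=
    MvPolynomial.exists_ne_zero_forall_jacobian_surjective (MilnorCurve.normalMap f)
  refine ⟨{a | MilnorCurve.polyFun Q a ≠ 0}, MilnorCurve.isOpen_polyFun_ne_zero Q,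
    MilnorCurve.dense_polyFun_ne_zero hQ0, fun a ha => ?_⟩
  refine (Set.eq_empty_or_nonempty _).symm.imp_left fun hne => ?_
  refine MilnorCurve.isNonsingularCurve_milnorSet_diff f (fun x hx => hQ x ?_) hne
  rw [funext hx]
  exact ha
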